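/- Let $f:\mathbb{C}[x,y]\to\mathbb{C}[x,y]$ be a $\mathbb{C}$-algebra endomorphism, put $p=f(x)$ and $q=f(y)$, and assume that the Jacobian determinant $p_xq_y-p_yq_x$ is a nonzero constant. Then there exist $u\in\mathbb{C}[p,q,x]\setminus\{0\}$ and $v\in\mathbb{C}[p,q]\setminus\{0\}$ such that $y=u/v$ in $\mathbb{C}(x,y)$; and for every such pair $(u,v)$ the following three conditions are equivalent: (i) $f$ is an automorphism of $\mathbb{C}[x,y]$; (ii) $f$ is birational, i.e. $\mathbb{C}(p,q)=\mathbb{C}(x,y)$; (iii) every invertible element of the ring $\mathbb{C}[p,q,x][1/v]\subset\mathbb{C}(x,y)$ belongs to $\mathbb{C}(p,q)\setminus\{0\}$. -/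

import Mathlib

namespace KellerPlane

/-- The polynomial ring `ℂ[x, y]`, with `x = X 0` and `y = X 1`. -/
abbrev Poly : Type := MvPolynomial (Fin 2) ℂ

/-- The field of rational functions `ℂ(x, y)`. -/
abbrev Rat2 : Type := FractionRing Poly

/-- The inclusion of `ℂ[x, y]` in `ℂ(x, y)`. -/
noncomputable abbrev incl : Poly →ₐ[ℂ] Rat2 := Algebra.algHom ℂ Poly Rat2

/-- The Jacobian determinant `p_x q_y - p_y q_x` of two polynomials in `x, y`. -/
noncomputable def jac (p q : Poly) : Poly :=
  Matrix.det !![MvPolynomial.pderiv 0 p, MvPolynomial.pderiv 1 p;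
                MvPolynomial.pderiv 0 q, MvPolynomial.pderiv 1 q]

/-- The Jacobian of `f`, i.e. that of `f x` and `f y`, is a nonzero constant. -/
def IsJacobian (f : Poly →ₐ[ℂ] Poly) : Prop :=
  ∃ c : ℂ, c ≠ 0 ∧ jac (f (MvPolynomial.X 0)) (f (MvPolynomial.X 1)) = MvPolynomial.C c

/-- `x` as an element of `ℂ(x, y)`. -/
noncomputable def xx : Rat2 := incl (MvPolynomial.X 0)

/-- `y` as an element of `ℂ(x, y)`. -/
noncomputable def yy : Rat2 := incl (MvPolynomial.X 1)

/-- `p = f x` as an element of `ℂ(x, y)`. -/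
noncomputable def pp (f : Poly →ₐ[ℂ] Poly) : Rat2 := incl (f (MvPolynomial.X 0))

/-- `q = f y` as an element of `ℂ(x, y)`. -/
noncomputable def qq (f : Poly →ₐ[ℂ] Poly) : Rat2 := incl (f (MvPolynomial.X 1))

/-- The subring `ℂ[p, q]` of `ℂ(x, y)`. -/
noncomputable def ringPQ (f : Poly →ₐ[ℂ] Poly) : Subalgebra ℂ Rat2 :=
  Algebra.adjoin ℂ {pp f, qq f}

/-- The subring `ℂ[p, q, x]` of `ℂ(x, y)`. -/
noncomputable def ringPQX (f : Poly →ₐ[ℂ] Poly) : Subalgebra ℂ Rat2 :=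
  Algebra.adjoin ℂ {pp f, qq f, xx}

/-- The subring `ℂ[p, q, x][1/v]` of `ℂ(x, y)`. -/
noncomputable def ringPQXInv (f : Poly →ₐ[ℂ] Poly) (v : Rat2) : Subalgebra ℂ Rat2 :=
  Algebra.adjoin ℂ {pp f, qq f, xx, v⁻¹}

/-- The subfield `ℂ(p, q)` of `ℂ(x, y)`. -/
noncomputable def fieldPQ (f : Poly →ₐ[ℂ] Poly) : IntermediateField ℂ Rat2 :=
  IntermediateField.adjoin ℂ {pp f, qq f}

/-- `y = u / v` with `u ∈ ℂ[p, q, x]` and `v ∈ ℂ[p, q]`, both nonzero. -/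
def IsFractionForY (f : Poly →ₐ[ℂ] Poly) (u v : Rat2) : Prop :=
  (u ∈ ringPQX f ∧ u ≠ 0) ∧ (v ∈ ringPQ f ∧ v ≠ 0) ∧ yy = u / v

/-- `f` is birational: `ℂ(p, q) = ℂ(x, y)`. -/
def IsBirational (f : Poly →ₐ[ℂ] Poly) : Prop := fieldPQ f = ⊤

/-- Every unit of `ℂ[p, q, x][1/v]` lies in `ℂ(p, q) ∖ 0`. -/
def UnitsInFieldPQ (f : Poly →ₐ[ℂ] Poly) (v : Rat2) : Prop :=
  ∀ w : (ringPQXInv f v)ˣ, ((w : ringPQXInv f v) : Rat2) ∈ (fieldPQ f : Set Rat2) \ {0}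

end KellerPlane

/-! ### Chain rule and injectivity of `f`. -/

namespace KellerPlane

open MvPolynomial

/-! The Jacobian condition is used in four ways.

Automorphism from birationality: `f` is injective (`IsJacobian.injective`), and `f t ∣ f s` forces
`t ∣ s` (`IsJacobian.dvd_of_map_dvd_map`), because a common prime factor of the images of coprime
polynomials would be a curve contracted to a point, where the Jacobian vanishes. Hence ℂ(p,q) ∩
ℂ[x,y] = ℂ[p,q].

Existence of (u, v): p_y and q_y have no common factor, and a degree argument on the minimal
polynomial of y then gives y ∈ ℂ(p,q,x) (`algebraMap_X_mem_of_derivative_coprime`). Since x is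
algebraic over ℂ(p,q), denominators can be taken in ℂ[p,q].

A particular unit: let H ∈ ℂ[P,Q][T] generate the relations of x over ℂ[p,q]. Then H'(x) is a unit
of ℂ[p,q,x][1/v] (`IsJacobian.exists_unit_eq`). Indeed, modulo H'(x) the relation H = 0 and the
Jacobian kill all first partials of H, so p and q can be deformed independently to first order with
x fixed. But with x fixed only y can move, a single parameter, so the quotient is zero
(`IsJacobian.one_eq_zero`).

Birationality from units: if H'(x) = a/b lies in ℂ(p,q), then bH' - a vanishes at x and has T-degree
below that of H, so it is zero. Thus H is linear in T, x ∈ ℂ(p,q), and then y ∈ ℂ(p,q). -/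

theorem pderiv_algHom_apply (f : Poly →ₐ[ℂ] Poly) (j : Fin 2) (g : Poly) :
    pderiv j (f g) = f (pderiv 0 g) * pderiv j (f (X 0)) +
      f (pderiv 1 g) * pderiv j (f (X 1)) := by
  induction g using MvPolynomial.induction_on with
  | C a =>
    have : f (C a) = C a := f.commutes a
    simp [this]
  | add p q hp hq => simp only [map_add, hp, hq]; ring
  | mul_X p i hp =>
    simp only [map_mul, Derivation.leibniz, smul_eq_mul, hp, map_add]
    fin_cases i <;> simp <;> ring

theorem jac_eq (p q : Poly) :
    jac p q = pderiv 0 p * pderiv 1 q - pderiv 1 p * pderiv 0 q := by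
  simp [jac, Matrix.det_fin_two]

theorem eq_C_of_pderiv_eq_zero {g : Poly} (h : ∀ i, pderiv i g = 0) : ∃ a, g = C a := by
  refine ⟨coeff 0 g, ?_⟩
  ext m
  rw [coeff_C]
  split_ifs with hm
  · rw [hm]
  · obtain ⟨i, hi⟩ : ∃ i, m i ≠ 0 := by
      by_contra! hcon
      exact hm (Finsupp.ext fun i => by simp [hcon i])
    have := congrArg (coeff (m - Finsupp.single i 1)) (h i)
    rw [coeff_pderiv, tsub_add_cancel_of_le (by simpa [Nat.one_le_iff_ne_zero] using hi)] at this
    simp only [coeff_zero, mul_eq_zero] at this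
    rcases this with h | h
    · exact h
    · exfalso; norm_cast at h

/-- A system with unit Jacobian determinant has only the zero solution. -/
theorem eq_zero_of_jac {R : Type*} [CommRing R] {a b p₀ p₁ q₀ q₁ : R}
    (hu : IsUnit (p₀ * q₁ - p₁ * q₀))
    (h₀ : a * p₀ + b * q₀ = 0) (h₁ : a * p₁ + b * q₁ = 0) : a = 0 ∧ b = 0 := by
  constructor
  · apply (hu.mul_left_eq_zero).1
    linear_combination q₁ * h₀ - q₀ * h₁
  · apply (hu.mul_left_eq_zero).1
    linear_combination p₀ * h₁ - p₁ * h₀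

theorem IsJacobian.isUnit {f : Poly →ₐ[ℂ] Poly} (hf : IsJacobian f) :
    IsUnit (pderiv 0 (f (X 0)) * pderiv 1 (f (X 1)) -
      pderiv 1 (f (X 0)) * pderiv 0 (f (X 1))) := by
  obtain ⟨c, hc, h⟩ := hf
  rw [← jac_eq, h]
  exact (Ne.isUnit hc).map C

theorem totalDegree_pderiv_lt {g : Poly} {i : Fin 2} (h : pderiv i g ≠ 0) :
    (pderiv i g).totalDegree < g.totalDegree := by
  have key : ∀ m ∈ (pderiv i g).support, (m.sum fun _ e => e) < g.totalDegree := by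
    intro m hm
    have hmem : m + Finsupp.single i 1 ∈ g.support := by
      rw [mem_support_iff] at hm ⊢
      rw [coeff_pderiv] at hm
      exact left_ne_zero_of_mul hm
    have := le_totalDegree hmem
    rw [Finsupp.sum_add_index' (by simp) (by simp), Finsupp.sum_single_index rfl] at this
    omega
  obtain ⟨m, hm⟩ := support_nonempty.2 h
  exact (Finset.sup_lt_iff ((Nat.zero_le _).trans_lt (key m hm))).2 key

theorem IsJacobian.injective {f : Poly →ₐ[ℂ] Poly} (hf : IsJacobian f) :
    Function.Injective f := by
  rw [injective_iff_map_eq_zero]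
  intro g
  induction hn : g.totalDegree using Nat.strong_induction_on generalizing g with
  | _ n ih =>
    intro hg
    have key := fun j => pderiv_algHom_apply f j g
    simp only [hg, map_zero] at key
    obtain ⟨h₀, h₁⟩ := eq_zero_of_jac hf.isUnit (key 0).symm (key 1).symm
    -- Both partials of `g` lie in the kernel and, if nonzero, have smaller degree, so the induction
    -- hypothesis kills them.
    have hz : ∀ i, pderiv i g = 0 := by
      intro i
      by_contra hne
      refine hne (ih _ (hn ▸ totalDegree_pderiv_lt hne) (pderiv i g) rfl ?_)
      fin_cases i
      exacts [h₀, h₁]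
    obtain ⟨a, rfl⟩ := eq_C_of_pderiv_eq_zero hz
    have : f (C a) = C a := f.commutes a
    rw [← this, hg]

end KellerPlane

/-! ### A birational Jacobian endomorphism is an automorphism. -/

namespace KellerPlane

open Polynomial in
/-- A prime `H` of `A[T]` and a polynomial it does not divide have a nonzero constant combination. -/
theorem exists_mul_add_mul_eq_C {A : Type*} [CommRing A] [IsDomain A]
    [UniqueFactorizationMonoid A] {H G : A[X]} (hH : Prime H) (hG : ¬ H ∣ G) :
    ∃ a b : A[X], ∃ r : A, r ≠ 0 ∧ a * H + b * G = C r := by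
  by_cases hd : H.natDegree = 0
  · rw [natDegree_eq_zero] at hd
    obtain ⟨r, rfl⟩ := hd
    refine ⟨1, 0, r, ?_, by simp⟩
    rintro rfl
    exact hH.ne_zero (by simp)
  let K := FractionRing A
  have hprim : H.IsPrimitive := hH.irreducible.isPrimitive hd
  have hirr : Irreducible (H.map (algebraMap A K)) :=
    hprim.irreducible_iff_irreducible_map_fraction_map.1 hH.irreducible
  have hnd : ¬ H.map (algebraMap A K) ∣ G.map (algebraMap A K) :=
    fun h => hG (hprim.dvd_of_fraction_map_dvd_fraction_map h)
  -- Gauss's lemma has moved the problem to K[T], where Bézout applies; what remains is clearing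
  -- denominators.
  obtain ⟨a, b, hab⟩ := (hirr.coprime_iff_not_dvd).2 hnd
  obtain ⟨c, hc, hc'⟩ := IsLocalization.integerNormalization_spec (nonZeroDivisors A) a
  obtain ⟨d, hd, hd'⟩ := IsLocalization.integerNormalization_spec (nonZeroDivisors A) b
  have hc0 := nonZeroDivisors.ne_zero hc
  have hd0 := nonZeroDivisors.ne_zero hd
  refine ⟨C d * IsLocalization.integerNormalization (nonZeroDivisors A) a,
    C c * IsLocalization.integerNormalization (nonZeroDivisors A) b, c * d,
    mul_ne_zero hc0 hd0, ?_⟩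
  apply map_injective (algebraMap A K) (IsFractionRing.injective A K)
  simp only [Polynomial.map_add, Polynomial.map_mul, map_C, hc', hd', map_mul]
  rw [← algebraMap_smul K c a, ← algebraMap_smul K d b, smul_eq_C_mul, smul_eq_C_mul]
  linear_combination (C (algebraMap A K c) * C (algebraMap A K d)) * hab

open MvPolynomial

/-- A prime `π` of `ℂ[x, y]` and a polynomial it does not divide have a nonzero combination
depending on one prescribed variable only. -/
theorem exists_mul_add_mul_eq_aeval {π s : Poly} (hπ : Prime π) (hs : ¬ π ∣ s) (i : Fin 2) :
    ∃ a b : Poly, ∃ r : Polynomial ℂ, r ≠ 0 ∧ a * π + b * s = Polynomial.aeval (X i) r := by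
  -- `e` puts the prescribed variable into the coefficient ring, so that the constant combination
  -- involves it alone.
  obtain ⟨e, he⟩ : ∃ e : Poly ≃ₐ[ℂ] Polynomial (Polynomial ℂ),
      e.symm (Polynomial.C Polynomial.X) = X i := by
    fin_cases i
    · exact ⟨(Polynomial.Bivariate.equivMvPolynomial ℂ).symm, by simp⟩
    · refine ⟨(renameEquiv ℂ (Equiv.swap 0 1)).trans
        (Polynomial.Bivariate.equivMvPolynomial ℂ).symm, by simp⟩
  obtain ⟨a, b, r, hr, h⟩ := exists_mul_add_mul_eq_C
    ((MulEquiv.prime_iff e).2 hπ) (mt (map_dvd_iff e).1 hs)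
  refine ⟨e.symm a, e.symm b, r, hr, ?_⟩
  have := congrArg e.symm h
  simp only [map_add, map_mul, AlgEquiv.symm_apply_apply] at this
  rw [this]
  have h2 : (e.symm.toAlgHom.comp ((Algebra.ofId (Polynomial ℂ)
      (Polynomial (Polynomial ℂ))).restrictScalars ℂ)) = Polynomial.aeval (X i) := by
    ext
    simp [Algebra.ofId_apply, he]
  exact DFunLike.congr_fun h2 r

/-- A prime dividing a value of a nonzero one-variable polynomial divides a translate. -/
theorem exists_dvd_sub_C {g p : Poly} (hg : Prime g) {r : Polynomial ℂ} (hr : r ≠ 0)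
    (h : g ∣ Polynomial.aeval p r) : ∃ α : ℂ, g ∣ p - C α := by
  rw [(IsAlgClosed.splits r).eq_prod_roots, map_mul] at h
  rcases hg.dvd_or_dvd h with h | h
  · refine absurd (isUnit_of_dvd_unit h ?_) hg.not_isUnit
    simpa using ((Polynomial.leadingCoeff_ne_zero.2 hr).isUnit.map (algebraMap ℂ Poly))
  · rw [map_multiset_prod, Multiset.map_map] at h
    obtain ⟨α, -, hα⟩ := hg.exists_mem_multiset_map_dvd h
    exact ⟨α, by simpa using hα⟩

/-- Modulo `g`, the gradients of p and q are both multiples of the gradient of `g`, so `g` divides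
the Jacobian. -/
theorem IsJacobian.not_dvd_sub_C {f : Poly →ₐ[ℂ] Poly} (hf : IsJacobian f) {g : Poly}
    (hg : ¬ IsUnit g) {α β : ℂ} (hp : g ∣ f (X 0) - C α) (hq : g ∣ f (X 1) - C β) : False := by
  obtain ⟨a, ha⟩ := hp
  obtain ⟨b, hb⟩ := hq
  refine hg (isUnit_of_dvd_unit ?_ hf.isUnit)
  rw [sub_eq_iff_eq_add] at ha hb
  simp only [ha, hb, map_add, Derivation.leibniz, smul_eq_mul, pderiv_C]
  exact ⟨(g * pderiv 0 a * pderiv 1 b + pderiv 0 a * b * pderiv 1 g + a * pderiv 0 g * pderiv 1 b)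
    - (g * pderiv 1 a * pderiv 0 b + pderiv 1 a * b * pderiv 0 g + a * pderiv 1 g * pderiv 0 b),
    by ring⟩

/-- A Jacobian endomorphism preserves coprimality. -/
theorem IsJacobian.not_dvd_map {f : Poly →ₐ[ℂ] Poly} (hf : IsJacobian f) {π s g : Poly}
    (hπ : Prime π) (hs : ¬ π ∣ s) (hg : Prime g) (h₁ : g ∣ f π) (h₂ : g ∣ f s) : False := by
  -- `π` and `s` have finitely many common zeros, so p and q must be constant on the curve `g = 0`.
  have key : ∀ i, ∃ α, g ∣ f (X i) - C α := by
    intro i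
    obtain ⟨a, b, r, hr, h⟩ := exists_mul_add_mul_eq_aeval hπ hs i
    refine exists_dvd_sub_C hg hr ?_
    rw [Polynomial.aeval_algHom_apply, ← h, map_add, map_mul, map_mul]
    exact dvd_add (h₁.mul_left _) (h₂.mul_left _)
  obtain ⟨α, hα⟩ := key 0
  obtain ⟨β, hβ⟩ := key 1
  exact hf.not_dvd_sub_C hg.not_isUnit hα hβ

theorem IsJacobian.isUnit_of_isUnit_map {f : Poly →ₐ[ℂ] Poly} (hf : IsJacobian f) {t : Poly}
    (ht : IsUnit (f t)) : IsUnit t := by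
  obtain ⟨a, ha, h⟩ := MvPolynomial.isUnit_iff_eq_C_of_isReduced.1 ht
  have : f (C a) = C a := f.commutes a
  rw [hf.injective (h.trans this.symm)]
  exact ha.map C

/-- Prime factors of `t` are peeled off one at a time: an irreducible factor of `f π` divides `f s`,
so preservation of coprimality gives `π ∣ s`. -/
theorem IsJacobian.dvd_of_map_dvd_map {f : Poly →ₐ[ℂ] Poly} (hf : IsJacobian f) {t : Poly}
    (ht : t ≠ 0) : ∀ s, f t ∣ f s → t ∣ s := by
  induction t using UniqueFactorizationMonoid.induction_on_prime with
  | h₁ => exact absurd rfl ht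
  | h₂ u hu => exact fun s _ => hu.dvd
  | h₃ a π ha hπ ih =>
    intro s h
    rw [map_mul] at h
    have hπs : π ∣ s := by
      by_contra hcon
      have hne : f π ≠ 0 := (map_ne_zero_iff f hf.injective).2 hπ.ne_zero
      obtain ⟨g, hg, hgd⟩ := WfDvdMonoid.exists_irreducible_factor
        (mt hf.isUnit_of_isUnit_map hπ.not_isUnit) hne
      exact hf.not_dvd_map hπ hcon hg.prime hgd (hgd.trans ((dvd_mul_right _ _).trans h))
    obtain ⟨s', rfl⟩ := hπs
    rw [map_mul] at h
    exact mul_dvd_mul_left _ (ih ha s' ((mul_dvd_mul_iff_left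
      ((map_ne_zero_iff f hf.injective).2 hπ.ne_zero)).1 h))

theorem mem_ringPQ {f : Poly →ₐ[ℂ] Poly} {z : Rat2} :
    z ∈ ringPQ f ↔ ∃ a, incl (f a) = z := by
  have : ringPQ f = (incl.comp f).range := by
    have hr : ({pp f, qq f} : Set Rat2) = Set.range ![pp f, qq f] := by simp [Set.pair_comm]
    rw [ringPQ, hr, Algebra.adjoin_range_eq_range_aeval]
    congr 1
    ext i
    fin_cases i <;> simp [pp, qq]
  rw [this]; rfl

theorem mem_fieldPQ {f : Poly →ₐ[ℂ] Poly} {z : Rat2} :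
    z ∈ fieldPQ f ↔ ∃ a b, z = incl (f a) / incl (f b) := by
  rw [fieldPQ, IntermediateField.mem_adjoin_iff_div]
  constructor
  · rintro ⟨r, hr, s, hs, rfl⟩
    obtain ⟨a, rfl⟩ := mem_ringPQ.1 hr
    obtain ⟨b, rfl⟩ := mem_ringPQ.1 hs
    exact ⟨a, b, rfl⟩
  · rintro ⟨a, b, rfl⟩
    exact ⟨_, mem_ringPQ.2 ⟨a, rfl⟩, _, mem_ringPQ.2 ⟨b, rfl⟩, rfl⟩

theorem incl_injective : Function.Injective incl := IsFractionRing.injective Poly Rat2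

/-- If b = f(s)/f(t), then f(t) divides f(s), hence t divides s and b = f(s/t). -/
theorem IsJacobian.mem_range {f : Poly →ₐ[ℂ] Poly} (hf : IsJacobian f) {b : Poly}
    (hb : incl b ∈ fieldPQ f) : b ∈ f.range := by
  obtain ⟨s, t, h⟩ := mem_fieldPQ.1 hb
  -- A zero denominator is allowed in `mem_fieldPQ`; the quotient is then 0.
  by_cases ht : t = 0
  · have : b = 0 := incl_injective (by simp [h, ht])
    rw [this]; exact zero_mem _
  have ht' : incl (f t) ≠ 0 :=
    (map_ne_zero_iff _ incl_injective).2 ((map_ne_zero_iff _ hf.injective).2 ht)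
  rw [eq_div_iff ht', ← map_mul] at h
  have h := incl_injective h
  obtain ⟨w, rfl⟩ := hf.dvd_of_map_dvd_map ht s ⟨b, by rw [← h, mul_comm]⟩
  rw [map_mul, mul_comm] at h
  exact ⟨w, (mul_left_cancel₀ ((map_ne_zero_iff _ hf.injective).2 ht) h).symm⟩

theorem IsJacobian.bijective_of_isBirational {f : Poly →ₐ[ℂ] Poly} (hf : IsJacobian f)
    (h : IsBirational f) : Function.Bijective f :=
  ⟨hf.injective, fun b => hf.mem_range (by rw [h]; trivial)⟩

theorem incl_mem_of_xx_mem_of_yy_mem {S : Subalgebra ℂ Rat2} (hx : xx ∈ S) (hy : yy ∈ S)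
    (b : Poly) : incl b ∈ S := by
  induction b using MvPolynomial.induction_on with
  | C a => exact S.algebraMap_mem a
  | add p q hp hq => rw [map_add]; exact add_mem hp hq
  | mul_X p i hp =>
    rw [map_mul]
    refine mul_mem hp ?_
    fin_cases i
    exacts [hx, hy]

theorem eq_top_of_xx_mem_of_yy_mem {k : IntermediateField ℂ Rat2} (hx : xx ∈ k) (hy : yy ∈ k) :
    k = ⊤ := by
  rw [eq_top_iff]
  rintro z -
  obtain ⟨a, b, -, rfl⟩ := IsFractionRing.div_surjective (A := Poly) z
  exact div_mem (incl_mem_of_xx_mem_of_yy_mem (S := k.toSubalgebra) hx hy a)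
    (incl_mem_of_xx_mem_of_yy_mem (S := k.toSubalgebra) hx hy b)

theorem isBirational_iff {f : Poly →ₐ[ℂ] Poly} :
    IsBirational f ↔ xx ∈ fieldPQ f ∧ yy ∈ fieldPQ f := by
  refine ⟨fun h => by rw [h]; exact ⟨trivial, trivial⟩, fun ⟨hx, hy⟩ => ?_⟩
  exact eq_top_of_xx_mem_of_yy_mem hx hy

theorem isBirational_of_bijective {f : Poly →ₐ[ℂ] Poly}
    (h : Function.Bijective f) : IsBirational f := by
  rw [isBirational_iff]
  constructor
  · obtain ⟨a, ha⟩ := h.2 (X 0)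
    exact mem_fieldPQ.2 ⟨a, 1, by simp [ha, xx]⟩
  · obtain ⟨a, ha⟩ := h.2 (X 1)
    exact mem_fieldPQ.2 ⟨a, 1, by simp [ha, yy]⟩

end KellerPlane

/-! ### Formanek's argument: y lies in ℂ(p,q,x). -/

namespace KellerPlane

section Formanek

open Polynomial

variable {R : Type*} [CommRing R]

/-- The substitution `T ↦ s Y` from `R[Y][T]` to `R[s][Y]`. -/
noncomputable def scaleHom (R : Type*) [CommRing R] : R[X][X] →+* R[X][X] :=
  eval₂RingHom (mapRingHom C) (C X * X)

theorem scaleHom_monomial (n : ℕ) (c : R[X]) :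
    scaleHom R (monomial n c) = C (X ^ n) * c.map C * X ^ n := by
  simp only [scaleHom, coe_eval₂RingHom, eval₂_monomial, coe_mapRingHom, mul_pow, C_pow]
  ring

/-- T^k Y^a goes to s^k Y^(k+a), so distinct monomials stay distinct and nothing cancels. -/
theorem coeff_coeff_scaleHom (G : R[X][X]) (k a : ℕ) :
    ((scaleHom R G).coeff (k + a)).coeff k = (G.coeff k).coeff a := by
  induction G using Polynomial.induction_on' with
  | add p q hp hq => simp [hp, hq]
  | monomial n c =>
    rw [scaleHom_monomial, coeff_mul_X_pow', coeff_monomial]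
    split_ifs with h₁ h₂ h₂
    · subst h₂
      rw [Nat.add_sub_cancel_left, coeff_C_mul, coeff_map, coeff_mul_C, coeff_X_pow_self, one_mul]
    · rw [coeff_C_mul, coeff_map, coeff_mul_C, coeff_X_pow, if_neg (Ne.symm h₂)]
      simp
    · omega
    · simp

theorem natDegree_eq_zero_of_scaleHom {G : R[X][X]} (h : (scaleHom R G).natDegree = 0) :
    G.natDegree = 0 := by
  by_contra hm
  have hG : G ≠ 0 := by rintro rfl; simp at hm
  have h₁ := coeff_coeff_scaleHom G G.natDegree (G.leadingCoeff).natDegree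
  rw [coeff_eq_zero_of_natDegree_lt (p := scaleHom R G) (by omega)] at h₁
  simp only [coeff_zero, coeff_natDegree] at h₁
  exact hG (leadingCoeff_eq_zero.1 (leadingCoeff_eq_zero.1 h₁.symm))

/-- Setting s = 1 in T = sY amounts to setting T = Y. -/
theorem map_eval_one_scaleHom (G : R[X][X]) :
    (scaleHom R G).map (evalRingHom 1) = G.eval X := by
  have : ((mapRingHom (evalRingHom (1 : R))).comp (scaleHom R)) = evalRingHom (X : R[X]) := by
    ext <;> simp [scaleHom]
  exact DFunLike.congr_fun this G

/-- The polynomial `p(T) - p(Y)` of `R[Y][T]`. -/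
noncomputable def diffPoly (p : R[X]) : R[X][X] := p.map C - C p

/-- The difference quotient; its diagonal value appears on differentiating in T and setting T = Y.
-/
theorem exists_diffPoly_eq (p : R[X]) :
    ∃ N : R[X][X], diffPoly p = (X - C X) * N ∧ N.eval X = derivative p := by
  have h0 : ∀ g : R[X], (g.map C).eval X = g := fun g => by rw [eval_map, eval₂_C_X]
  obtain ⟨N, hN⟩ := X_sub_C_dvd_sub_C_eval (a := X) (p := p.map C)
  rw [h0] at hN
  refine ⟨N, hN, ?_⟩
  have := congrArg (fun g => (derivative g).eval X) hN
  simpa [derivative_map, h0, derivative_mul] using this.symm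

theorem coeff_scaleHom_diffPoly (p : R[X]) (k : ℕ) :
    (scaleHom R (diffPoly p)).coeff k = C (p.coeff k) * (X ^ k - 1) := by
  induction p using Polynomial.induction_on' with
  | add p q hp hq =>
    have : diffPoly (p + q) = diffPoly p + diffPoly q := by
      simp only [diffPoly, Polynomial.map_add, C_add]; ring
    simp only [this, map_add, coeff_add, hp, hq]; ring
  | monomial n c =>
    have h : scaleHom R (C (monomial n c)) = monomial n (C c) := by simp [scaleHom]
    rw [diffPoly, map_sub, h, map_monomial, scaleHom_monomial, coeff_sub, map_C, ← C_mul,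
      C_mul_X_pow_eq_monomial, coeff_monomial, coeff_monomial, coeff_monomial]
    split_ifs with hk
    · subst hk; ring
    · simp

variable [IsDomain R] [CharZero R]

/-- Put T = sY. The leading coefficient in Y of (p(T) - p(Y))/(T - Y) is lc(p)(1 + s + ... +
s^(n-1)) with n = deg p, nonzero at s = 1. The same then holds for its divisor ν, so specializing s
= 1 keeps the Y-degree of ν(sY, Y). That degree is 0 because ν(Y, Y) is a unit. -/
theorem natDegree_eq_zero_of_isUnit_eval {p : R[X]} (hp : p.natDegree ≠ 0) {ν : R[X][X]}
    (h : (X - C X) * ν ∣ diffPoly p) (hu : IsUnit (ν.eval X)) : ν.natDegree = 0 := by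
  obtain ⟨N, hN, -⟩ := exists_diffPoly_eq p
  rw [hN, mul_dvd_mul_iff_left (X_sub_C_ne_zero _)] at h
  have hσ : scaleHom R (X - C X) = C (X - 1) * X := by simp [scaleHom, sub_mul]
  have hp0 : p.leadingCoeff ≠ 0 := leadingCoeff_ne_zero.2 (by rintro rfl; simp at hp)
  have hlead : (scaleHom R (diffPoly p)).leadingCoeff =
      C p.leadingCoeff * (X ^ p.natDegree - 1) := by
    have hd : (scaleHom R (diffPoly p)).natDegree = p.natDegree := by
      apply natDegree_eq_of_le_of_coeff_ne_zero
      · refine natDegree_le_iff_coeff_eq_zero.2 fun k hk => ?_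
        rw [coeff_scaleHom_diffPoly, coeff_eq_zero_of_natDegree_lt hk]
        simp
      · rw [coeff_scaleHom_diffPoly]
        exact mul_ne_zero (C_ne_zero.2 hp0) (X_pow_sub_C_ne_zero (Nat.pos_of_ne_zero hp) 1)
    rw [leadingCoeff, hd, coeff_scaleHom_diffPoly]; rfl
  have hlN : (scaleHom R N).leadingCoeff =
      C p.leadingCoeff * ∑ i ∈ Finset.range p.natDegree, X ^ i := by
    rw [hN, map_mul, hσ, leadingCoeff_mul, leadingCoeff_mul, leadingCoeff_C, leadingCoeff_X,
      mul_one, ← mul_geom_sum] at hlead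
    exact mul_left_cancel₀ (X_sub_C_ne_zero (1 : R)) (by rw [C_1]; linear_combination hlead)
  have hne : (scaleHom R ν).leadingCoeff.eval 1 ≠ 0 := by
    intro h0
    obtain ⟨w, rfl⟩ := h
    rw [map_mul, leadingCoeff_mul] at hlN
    have := congrArg (eval 1) hlN
    rw [eval_mul, h0] at this
    -- At s = 1 the geometric sum is deg p, nonzero in characteristic 0.
    simp only [zero_mul, eval_mul, eval_C, eval_finsetSum, eval_pow, eval_X, one_pow,
      Finset.sum_const, Finset.card_range, nsmul_eq_mul, mul_one] at this
    exact mul_ne_zero hp0 (Nat.cast_ne_zero.2 hp) this.symm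
  apply natDegree_eq_zero_of_scaleHom
  rw [← natDegree_map_of_leadingCoeff_ne_zero (evalRingHom (1 : R)) hne, map_eval_one_scaleHom]
  exact natDegree_eq_zero_of_isUnit hu

theorem exists_isPrimitive_map_eq {B F : Type*} [CommRing B] [IsDomain B]
    [UniqueFactorizationMonoid B] [Field F] [Algebra B F] [IsFractionRing B F] {g : F[X]}
    (hg : g ≠ 0) : ∃ g₀ : B[X], g₀.IsPrimitive ∧ ∃ c : F, c ≠ 0 ∧
      g₀.map (algebraMap B F) = C c * g := by
  let : NormalizedGCDMonoid B := Nonempty.some inferInstance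
  obtain ⟨b, hb, hb'⟩ := IsLocalization.integerNormalization_spec (nonZeroDivisors B) g
  set N := IsLocalization.integerNormalization (nonZeroDivisors B) g
  have hb0 : algebraMap B F b ≠ 0 :=
    IsFractionRing.to_map_ne_zero_of_mem_nonZeroDivisors hb
  rw [← algebraMap_smul F, smul_eq_C_mul] at hb'
  have hN : N ≠ 0 := by
    rintro h
    rw [h, Polynomial.map_zero] at hb'
    exact mul_ne_zero (C_ne_zero.2 hb0) hg hb'.symm
  have hc : algebraMap B F N.content ≠ 0 := by
    rw [Ne, FaithfulSMul.algebraMap_eq_zero_iff, content_eq_zero_iff]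
    exact hN
  refine ⟨N.primPart, N.isPrimitive_primPart, (algebraMap B F N.content)⁻¹ * algebraMap B F b,
    mul_ne_zero (inv_ne_zero hc) hb0, ?_⟩
  rw [C_mul, mul_assoc, ← hb']
  have hmap := congrArg (Polynomial.map (algebraMap B F)) N.eq_C_content_mul_primPart
  rw [Polynomial.map_mul, map_C] at hmap
  rw [hmap, ← mul_assoc, ← C_mul, inv_mul_cancel₀ hc, C_1, one_mul]

/-- If `p, q ∈ R[Y]` have derivatives without common factor, then a subfield of the fraction field
of `R[Y]` which contains `R`, `p` and `q` contains `Y`. -/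
theorem algebraMap_X_mem_of_derivative_coprime [UniqueFactorizationMonoid R]
    {F : Type*} [Field F] [Algebra R[X] F]
    [IsFractionRing R[X] F] {p q : R[X]}
    (hpq : ∀ d, d ∣ derivative p → d ∣ derivative q → IsUnit d) (k : Subfield F)
    (hR : ∀ r, algebraMap R[X] F (C r) ∈ k) (hp : algebraMap R[X] F p ∈ k)
    (hq : algebraMap R[X] F q ∈ k) : algebraMap R[X] F X ∈ k := by
  set y := algebraMap R[X] F X with hy
  let ι : R →+* k := ((algebraMap R[X] F).comp C).codRestrict k hR
  have hι : (algebraMap k F).comp ι = (algebraMap R[X] F).comp C := by ext; rfl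
  have hlift : ∀ g, ∀ hg : algebraMap R[X] F g ∈ k,
      (g.map ι - C (⟨algebraMap R[X] F g, hg⟩ : k)).map (algebraMap k F) =
        (diffPoly g).map (algebraMap R[X] F) := by
    intro g hg
    simp only [diffPoly, Polynomial.map_sub, Polynomial.map_map, hι, map_C]
    rfl
  have hroot : ∀ g, ∀ hg : algebraMap R[X] F g ∈ k,
      aeval y (g.map ι - C (⟨algebraMap R[X] F g, hg⟩ : k)) = 0 := by
    intro g hg
    obtain ⟨N, hN, -⟩ := exists_diffPoly_eq g
    rw [aeval_def, ← eval_map, hlift, hN]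
    simp [hy]
  have hdvd : ∀ g, algebraMap R[X] F g ∈ k →
      (minpoly k y).map (algebraMap k F) ∣ (diffPoly g).map (algebraMap R[X] F) := by
    intro g hg
    rw [← hlift g hg]
    exact map_dvd (mapRingHom (algebraMap k F)) (minpoly.dvd k y (hroot g hg))
  -- If both p and q were constant in Y, then 0 would be a common divisor of their derivatives.
  obtain ⟨g, hg, hgd⟩ : ∃ g, algebraMap R[X] F g ∈ k ∧ g.natDegree ≠ 0 := by
    by_contra! hcon
    refine not_isUnit_zero (hpq 0 ?_ ?_)
    · rw [derivative_of_natDegree_zero (hcon p hp)]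
    · rw [derivative_of_natDegree_zero (hcon q hq)]
  have hint : IsIntegral k y := by
    rw [← isAlgebraic_iff_isIntegral]
    refine ⟨_, ?_, hroot g hg⟩
    intro h0
    have hι_inj : Function.Injective ι := by
      apply Function.Injective.of_comp (f := algebraMap k F)
      rw [← RingHom.coe_comp, hι]
      exact (IsFractionRing.injective R[X] F).comp C_injective
    have := congrArg natDegree h0
    rw [natDegree_sub_C, natDegree_map_eq_of_injective hι_inj, natDegree_zero] at this
    exact hgd this
  have hμ : (minpoly k y).map (algebraMap k F) ≠ 0 :=
    ((minpoly.monic hint).map _).ne_zero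
  -- A primitive multiple of the minimal polynomial lets Gauss's lemma bring the divisibility down
  -- to R[Y][T].
  obtain ⟨μ, hprim, c, hc, hμc⟩ := exists_isPrimitive_map_eq (B := R[X]) hμ
  have hdvd' : ∀ g, algebraMap R[X] F g ∈ k → μ ∣ diffPoly g := by
    intro g hg
    refine hprim.dvd_of_fraction_map_dvd_fraction_map (K := F) ?_
    rw [hμc]
    exact (C_mul_dvd hc).2 (hdvd g hg)
  have hμroot : μ.IsRoot X := by
    apply IsFractionRing.injective R[X] F
    rw [map_zero, ← eval₂_at_apply, ← eval_map, hμc]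
    rw [eval_mul, eval_map_algebraMap, ← hy, minpoly.aeval, mul_zero]
  obtain ⟨ν, rfl⟩ := dvd_iff_isRoot.2 hμroot
  -- Cancel T - Y and set T = Y.
  have hder : ∀ g, algebraMap R[X] F g ∈ k → ν.eval X ∣ derivative g := by
    intro g hg
    have := hdvd' g hg
    obtain ⟨N, hN, hN'⟩ := exists_diffPoly_eq g
    rw [hN, mul_dvd_mul_iff_left (X_sub_C_ne_zero _)] at this
    rw [← hN']
    exact eval_dvd this
  have hν := natDegree_eq_zero_of_isUnit_eval hgd (hdvd' g hg) (hpq _ (hder p hp) (hder q hq))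
  have hν0 : ν ≠ 0 := by
    rintro rfl
    rw [mul_zero, Polynomial.map_zero] at hμc
    exact mul_ne_zero (C_ne_zero.2 hc) hμ hμc.symm
  have hdeg : (minpoly k y).natDegree = 1 := by
    have := congrArg natDegree hμc
    rw [natDegree_map_eq_of_injective (IsFractionRing.injective R[X] F), natDegree_C_mul hc,
      natDegree_map, natDegree_mul (X_sub_C_ne_zero _) hν0, hν,
      natDegree_X_sub_C] at this
    exact this.symm
  obtain ⟨z, hz⟩ := minpoly.natDegree_eq_one_iff.1 hdeg
  rw [← hz]
  exact z.2

end Formanek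

end KellerPlane

/-! ### Existence of u and v. -/

namespace KellerPlane

open MvPolynomial

theorem IsJacobian.yy_mem {f : Poly →ₐ[ℂ] Poly} (hf : IsJacobian f)
    {k : IntermediateField ℂ Rat2} (hp : pp f ∈ k) (hq : qq f ∈ k) (hx : xx ∈ k) : yy ∈ k := by
  let e := Polynomial.Bivariate.equivMvPolynomial ℂ
  let : Algebra (Polynomial (Polynomial ℂ)) Rat2 :=
    ((algebraMap Poly Rat2).comp e.toRingEquiv.toRingHom).toAlgebra
  have hal : ∀ g, algebraMap (Polynomial (Polynomial ℂ)) Rat2 g = incl (e g) := fun _ => rfl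
  have : IsFractionRing (Polynomial (Polynomial ℂ)) Rat2 :=
    (IsFractionRing.isFractionRing_iff_of_base_ringEquiv (R := Poly) Rat2
      e.symm.toRingEquiv).1 inferInstance
  have hder : ∀ g d, d ∣ Polynomial.derivative (e.symm g) → e d ∣ pderiv 1 g := by
    intro g d hd
    have := Polynomial.Bivariate.pderiv_one_equivMvPolynomial (e.symm g)
    rw [show Polynomial.Bivariate.equivMvPolynomial ℂ (e.symm g) = g from
      e.apply_symm_apply g] at this
    rw [this]
    exact map_dvd e hd
  have := algebraMap_X_mem_of_derivative_coprime (F := Rat2) (p := e.symm (f (X 0)))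
    (q := e.symm (f (X 1))) ?_ k.toSubfield ?_ ?_ ?_
  · rw [hal] at this
    simpa [e, yy] using this
  -- A common divisor of p_y and q_y divides the Jacobian.
  · intro d hdp hdq
    have h : IsUnit (e d) := isUnit_of_dvd_unit
      (dvd_sub ((hder _ _ hdq).mul_left _) ((hder _ _ hdp).mul_right _)) hf.isUnit
    exact (isUnit_map_iff e d).1 h
  · intro r
    rw [hal]
    change _ ∈ k
    induction r using Polynomial.induction_on' with
    | add p q hp hq => rw [Polynomial.C_add, map_add, map_add]; exact add_mem hp hq
    | monomial n a =>
      rw [← Polynomial.C_mul_X_pow_eq_monomial]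
      simp only [map_mul, map_pow, e, Polynomial.Bivariate.equivMvPolynomial_C_C,
        Polynomial.Bivariate.equivMvPolynomial_C_X]
      exact mul_mem (k.algebraMap_mem a) (pow_mem hx n)
  · rw [hal, e.apply_symm_apply]; exact hp
  · rw [hal, e.apply_symm_apply]; exact hq

/-- Injectivity of `f` makes p, q algebraically independent, and the transcendence degree of ℂ(x,y)
is 2. -/
theorem IsJacobian.isTranscendenceBasis {f : Poly →ₐ[ℂ] Poly} (hf : IsJacobian f) :
    IsTranscendenceBasis ℂ ![pp f, qq f] := by
  have hind : AlgebraicIndependent ℂ ![pp f, qq f] := by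
    have : (aeval ![pp f, qq f] : Poly →ₐ[ℂ] Rat2) = incl.comp f := by
      ext i
      fin_cases i <;> simp [pp, qq]
    rw [AlgebraicIndependent, this]
    exact incl_injective.comp hf.injective
  have : Algebra.IsAlgebraic Poly Rat2 := IsLocalization.isAlgebraic Rat2 (nonZeroDivisors Poly)
  have hX := (IsTranscendenceBasis.mvPolynomial (Fin 2) ℂ).algebraMap_comp (A := Rat2)
  exact hind.isTranscendenceBasis_of_trdeg_le_of_finite hX.cardinalMk_eq_trdeg.ge

theorem range_pp_qq (f : Poly →ₐ[ℂ] Poly) : Set.range ![pp f, qq f] = {pp f, qq f} := by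
  simp [Set.pair_comm]

theorem IsJacobian.isAlgebraic {f : Poly →ₐ[ℂ] Poly} (hf : IsJacobian f) :
    Algebra.IsAlgebraic (fieldPQ f) Rat2 := by
  have := hf.isTranscendenceBasis.isAlgebraic_field
  rwa [range_pp_qq] at this

theorem IsJacobian.isAlgebraic_ringPQ {f : Poly →ₐ[ℂ] Poly} (hf : IsJacobian f) :
    Algebra.IsAlgebraic (ringPQ f) Rat2 := by
  have := hf.isTranscendenceBasis.isAlgebraic
  rwa [range_pp_qq] at this

theorem ringPQ_le_ringPQX (f : Poly →ₐ[ℂ] Poly) : ringPQ f ≤ ringPQX f :=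
  Algebra.adjoin_mono (by intro z; simp; tauto)

theorem IsJacobian.yy_mem_of_xx_mem {f : Poly →ₐ[ℂ] Poly} (hf : IsJacobian f)
    {L : IntermediateField (fieldPQ f) Rat2} (hx : xx ∈ L) : yy ∈ L := by
  have hle : ∀ z ∈ fieldPQ f, z ∈ L.restrictScalars ℂ :=
    fun z hz => L.algebraMap_mem ⟨z, hz⟩
  have hp : pp f ∈ fieldPQ f := IntermediateField.subset_adjoin _ _ (Or.inl rfl)
  have hq : qq f ∈ fieldPQ f := IntermediateField.subset_adjoin _ _ (Or.inr rfl)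
  exact (IntermediateField.mem_restrictScalars ℂ).1
    (hf.yy_mem (hle _ hp) (hle _ hq) ((IntermediateField.mem_restrictScalars ℂ).2 hx))

/-- As x is algebraic, ℂ(p,q)(x) = ℂ(p,q)[x], so y is a polynomial in x whose coefficients have
denominators in ℂ[p,q]. -/
theorem IsJacobian.exists_isFractionForY {f : Poly →ₐ[ℂ] Poly} (hf : IsJacobian f) :
    ∃ u v, IsFractionForY f u v := by
  have halg := hf.isAlgebraic
  have hy : yy ∈ IntermediateField.adjoin (fieldPQ f) {xx} :=
    hf.yy_mem_of_xx_mem (IntermediateField.subset_adjoin _ _ rfl)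
  rw [← IntermediateField.mem_toSubalgebra,
    IntermediateField.adjoin_simple_toSubalgebra_of_isAlgebraic
      (Algebra.IsAlgebraic.isAlgebraic xx)] at hy
  have key : ∀ z ∈ Algebra.adjoin (fieldPQ f) {xx},
      ∃ u ∈ ringPQX f, ∃ v ∈ ringPQ f, v ≠ 0 ∧ z = u / v := by
    intro z hz
    induction hz using Algebra.adjoin_induction with
    | mem z hz =>
      rw [Set.mem_singleton_iff.1 hz]
      exact ⟨xx, Algebra.subset_adjoin (by simp), 1, one_mem _, one_ne_zero, by simp⟩
    | algebraMap r =>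
      obtain ⟨a, b, h⟩ := mem_fieldPQ.1 r.2
      by_cases hb : incl (f b) = 0
      · refine ⟨0, zero_mem _, 1, one_mem _, one_ne_zero, ?_⟩
        rw [hb, div_zero] at h
        simpa using h
      · exact ⟨_, ringPQ_le_ringPQX f (mem_ringPQ.2 ⟨a, rfl⟩), _, mem_ringPQ.2 ⟨b, rfl⟩, hb, h⟩
    | add a b _ _ ha hb =>
      obtain ⟨u, hu, v, hv, hv0, rfl⟩ := ha
      obtain ⟨u', hu', v', hv', hv0', rfl⟩ := hb
      exact ⟨u * v' + v * u', add_mem (mul_mem hu (ringPQ_le_ringPQX f hv'))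
        (mul_mem (ringPQ_le_ringPQX f hv) hu'), v * v', mul_mem hv hv', mul_ne_zero hv0 hv0',
        div_add_div _ _ hv0 hv0'⟩
    | mul a b _ _ ha hb =>
      obtain ⟨u, hu, v, hv, hv0, rfl⟩ := ha
      obtain ⟨u', hu', v', hv', hv0', rfl⟩ := hb
      exact ⟨u * u', mul_mem hu hu', v * v', mul_mem hv hv', mul_ne_zero hv0 hv0',
        div_mul_div_comm _ _ _ _⟩
  obtain ⟨u, hu, v, hv, hv0, h⟩ := key _ hy
  refine ⟨u, v, ⟨hu, ?_⟩, ⟨hv, hv0⟩, h⟩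
  rintro rfl
  rw [zero_div] at h
  exact X_ne_zero (1 : Fin 2) (incl_injective (h.trans (map_zero incl).symm))

/-! ### First-order deformations of p and q with x fixed. -/

open TrivSqZeroExt

/-- The first-order Taylor expansion of a polynomial at a point with values in dual numbers. -/
theorem aeval_inl_add_inr {S : Type*} [CommRing S] [Algebra ℂ S] (a e : Fin 2 → S) (g : Poly) :
    aeval (R := ℂ) (S₁ := DualNumber S) (fun i => inl (a i) + inr (e i)) g =
      inl (aeval a g) + inr (aeval a (pderiv 0 g) * e 0 + aeval a (pderiv 1 g) * e 1) := by
  induction g using MvPolynomial.induction_on with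
  | C c => ext <;> simp [algebraMap_eq_inl']
  | add p q hp hq =>
    rw [map_add, hp, hq]
    ext <;> simp
    ring
  | mul_X p i hp =>
    rw [map_mul, hp, aeval_X]
    ext
    · simp
    · fin_cases i <;> simp <;> ring

/-- The substitution `P ↦ p, Q ↦ q, T ↦ x` from `ℂ[P, Q][T]` to `ℂ[x, y]`. -/
noncomputable def evalX (f : Poly →ₐ[ℂ] Poly) : Polynomial Poly →+* Poly :=
  Polynomial.eval₂RingHom (f : Poly →+* Poly) (X 0)

theorem evalX_C (f : Poly →ₐ[ℂ] Poly) (a : Poly) : evalX f (Polynomial.C a) = f a := by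
  simp [evalX]

theorem evalX_X (f : Poly →ₐ[ℂ] Poly) : evalX f Polynomial.X = X 0 := by
  simp [evalX]

/-- If `y · f V` is the value of `U`, a homomorphism from `ℂ[P, Q][T]` which vanishes on the
relations between `p, q, x` and inverts `V` is determined by a point of the plane. -/
theorem map_eq_aeval {W : Type*} [CommRing W] [Algebra ℂ W] {f : Poly →ₐ[ℂ] Poly}
    (Ψ : Polynomial Poly →+* W) (hC : ∀ c : ℂ, Ψ (Polynomial.C (C c)) = algebraMap ℂ W c)
    (hker : ∀ G, evalX f G = 0 → Ψ G = 0) {U : Polynomial Poly} {V : Poly}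
    (hU : evalX f U = X 1 * f V) (hV : IsUnit (Ψ (Polynomial.C V))) {y : W}
    (hy : Ψ U = y * Ψ (Polynomial.C V)) {G : Polynomial Poly} {g : Poly} (hG : evalX f G = g) :
    Ψ G = aeval ![Ψ Polynomial.X, y] g := by
  -- Instead of localizing, multiply `g` by a power of `f V` to reach the image of `evalX`; the
  -- power cancels at the end since `Ψ V` is a unit.
  have key : ∀ g : Poly, ∃ N : ℕ, ∃ G, evalX f G = f V ^ N * g ∧
      Ψ G = Ψ (Polynomial.C V) ^ N * aeval ![Ψ Polynomial.X, y] g := by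
    intro g
    induction g using MvPolynomial.induction_on with
    | C c => exact ⟨0, Polynomial.C (C c), by simp [evalX_C], by simp [hC]⟩
    | add p q hp hq =>
      obtain ⟨N, G, h₁, h₂⟩ := hp
      obtain ⟨N', G', h₁', h₂'⟩ := hq
      refine ⟨N + N', Polynomial.C V ^ N' * G + Polynomial.C V ^ N * G', ?_, ?_⟩
      · simp only [map_add, map_mul, map_pow, evalX_C, h₁, h₁']; ring
      · simp only [map_add, map_mul, map_pow, h₂, h₂']; ring
    | mul_X p i hp =>
      obtain ⟨N, G, h₁, h₂⟩ := hp
      fin_cases i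
      · refine ⟨N, G * Polynomial.X, ?_, ?_⟩
        · simp [h₁, evalX_X, mul_assoc]
        · simp [h₂, mul_assoc]
      · refine ⟨N + 1, G * U, ?_, ?_⟩
        · rw [map_mul, h₁, hU]; simp; ring
        · rw [map_mul, h₂, hy]; simp; ring
  obtain ⟨N, G', h₁, h₂⟩ := key g
  have h := hker (G' - Polynomial.C V ^ N * G) (by simp [h₁, evalX_C, hG])
  rw [map_sub, map_mul, map_pow, h₂, ← mul_sub] at h
  exact (sub_eq_zero.1 (((hV.pow N).mul_right_eq_zero).1 h)).symm

/-- The homomorphism from `ℂ[P, Q][T]` to dual numbers with `T ↦ x` and `P ↦ p + ε, Q ↦ q` (for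
`i = 0`) or `P ↦ p, Q ↦ q + ε` (for `i = 1`). -/
noncomputable def dualHom {M : Type*} [CommRing M] [Algebra ℂ M] (f : Poly →ₐ[ℂ] Poly)
    (m : Poly →ₐ[ℂ] M) (i : Fin 2) : Polynomial Poly →+* DualNumber M :=
  Polynomial.eval₂RingHom
    ((aeval (R := ℂ) fun j => inl (m (f (X j))) + inr ((Pi.single i 1 : Fin 2 → M) j) :
      Poly →ₐ[ℂ] DualNumber M) : Poly →+* DualNumber M) (inl (m (X 0)))

section dualHom

variable {M : Type*} [CommRing M] [Algebra ℂ M] (f : Poly →ₐ[ℂ] Poly) (m : Poly →ₐ[ℂ] M)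

theorem dualHom_X (i : Fin 2) : dualHom f m i Polynomial.X = inl (m (X 0)) := by
  simp [dualHom]

theorem dualHom_C (i : Fin 2) (a : Poly) :
    dualHom f m i (Polynomial.C a) = inl (m (f a)) + inr (m (f (pderiv i a))) := by
  have h : (aeval fun j => m (f (X j)) : Poly →ₐ[ℂ] M) = m.comp f := by ext; simp
  simp only [dualHom, Polynomial.coe_eval₂RingHom, Polynomial.eval₂_C, RingHom.coe_coe]
  rw [aeval_inl_add_inr (fun j => m (f (X j))) (Pi.single i 1), h]
  fin_cases i <;> simp

theorem fst_dualHom (i : Fin 2) (G : Polynomial Poly) :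
    (dualHom f m i G).fst = m (evalX f G) := by
  induction G using Polynomial.induction_on with
  | C a => simp [dualHom_C, evalX_C]
  | add p q hp hq => simp [hp, hq]
  | monomial n a h => simp [dualHom_C, dualHom_X, evalX_C, evalX_X]

/-- The chain rule for G(p,q,x): the two ε-coefficients are the values of ∂G/∂P and ∂G/∂Q. -/
theorem map_pderiv_evalX (j : Fin 2) (G : Polynomial Poly) :
    m (pderiv j (evalX f G)) = (dualHom f m 0 G).snd * m (pderiv j (f (X 0))) +
      (dualHom f m 1 G).snd * m (pderiv j (f (X 1))) +
      m (evalX f (Polynomial.derivative G)) * m (pderiv j (X 0)) := by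
  induction G using Polynomial.induction_on with
  | C a => simp [dualHom_C, evalX_C, pderiv_algHom_apply f j a]
  | add p q hp hq => simp only [map_add, hp, hq, snd_add]; ring
  | monomial n a h =>
    rw [pow_succ, ← mul_assoc]
    generalize Polynomial.C a * Polynomial.X ^ n = G at h ⊢
    rw [map_mul, Derivation.leibniz, map_mul (dualHom f m 0), map_mul (dualHom f m 1), snd_mul, snd_mul, dualHom_X, dualHom_X,
      fst_dualHom, fst_dualHom, Polynomial.derivative_mul, Polynomial.derivative_X]
    simp only [smul_eq_mul, map_add, map_mul, h, evalX_X, fst_inl, snd_inl, mul_one,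
      MulOpposite.smul_eq_mul_unop, MulOpposite.unop_op]
    ring

end dualHom

/-- Otherwise a combination of `H` and `G` would be a nonzero element of ℂ[P,Q] killed by `f`. -/
theorem IsJacobian.dvd_of_evalX_eq_zero {f : Poly →ₐ[ℂ] Poly} (hf : IsJacobian f)
    {H G : Polynomial Poly} (hH : Prime H) (h : evalX f H = 0) (hG : evalX f G = 0) : H ∣ G := by
  by_contra hcon
  obtain ⟨a, b, r, hr, he⟩ := exists_mul_add_mul_eq_C hH hcon
  have := congrArg (evalX f) he
  rw [map_add, map_mul, map_mul, h, hG, evalX_C, mul_zero, mul_zero, add_zero] at this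
  exact hr (hf.injective (by rw [← this, map_zero]))

/-- Algebraicity of x over ℂ[p,q] makes the kernel a nonzero prime ideal, which in a factorial ring
contains a prime element. -/
theorem IsJacobian.exists_prime_evalX_eq_zero {f : Poly →ₐ[ℂ] Poly} (hf : IsJacobian f) :
    ∃ H, Prime H ∧ evalX f H = 0 := by
  have halg := hf.isAlgebraic_ringPQ
  obtain ⟨g, hg, hg0⟩ := halg.isAlgebraic xx
  let σ : Poly →+* ringPQ f :=
    ((incl.comp f).codRestrict (ringPQ f) fun a => mem_ringPQ.2 ⟨a, rfl⟩ : Poly →ₐ[ℂ] ringPQ f)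
  have hσ : Function.Surjective σ := by
    rintro ⟨z, hz⟩
    obtain ⟨a, rfl⟩ := mem_ringPQ.1 hz
    exact ⟨a, rfl⟩
  obtain ⟨G, rfl⟩ := Polynomial.map_surjective σ hσ g
  have hev : ∀ G, Polynomial.aeval xx (G.map σ) = incl (evalX f G) := by
    intro G
    rw [Polynomial.aeval_def, Polynomial.eval₂_map, evalX, Polynomial.coe_eval₂RingHom,
      ← AlgHom.coe_toRingHom, Polynomial.hom_eval₂]
    rfl
  rw [hev, map_eq_zero_iff _ incl_injective] at hg0
  have hne : RingHom.ker (evalX f) ≠ ⊥ := by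
    intro hbot
    have : G ∈ RingHom.ker (evalX f) := hg0
    rw [hbot, Ideal.mem_bot] at this
    exact hg (by rw [this, Polynomial.map_zero])
  obtain ⟨H, hmem, hH⟩ := (RingHom.ker_isPrime (evalX f)).exists_mem_prime_of_ne_bot hne
  exact ⟨H, hH, hmem⟩

/-- A quotient of the smooth ring `ℂ[p, q, x][1/v]` in which `H'(x)` vanishes is zero. -/
theorem IsJacobian.one_eq_zero {M : Type*} [CommRing M] [Algebra ℂ M] {f : Poly →ₐ[ℂ] Poly}
    (hf : IsJacobian f) (m : Poly →ₐ[ℂ] M) {H U : Polynomial Poly} {V : Poly} (hH : Prime H)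
    (hH0 : evalX f H = 0) (hder : m (evalX f (Polynomial.derivative H)) = 0)
    (hU : evalX f U = X 1 * f V) (hV : IsUnit (m (f V))) : (1 : M) = 0 := by
  have hdual : ∀ i, dualHom f m i H = 0 := by
    have key := fun j => map_pderiv_evalX f m j H
    simp only [hH0, hder, map_zero, zero_mul, add_zero] at key
    have hu : IsUnit (m (pderiv 0 (f (X 0))) * m (pderiv 1 (f (X 1))) -
        m (pderiv 1 (f (X 0))) * m (pderiv 0 (f (X 1)))) := by
      simpa using hf.isUnit.map m
    obtain ⟨h₀, h₁⟩ := eq_zero_of_jac hu (key 0).symm (key 1).symm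
    intro i
    ext
    · rw [fst_dualHom, hH0, map_zero, fst_zero]
    · fin_cases i
      exacts [h₀, h₁]
  -- The deformation fixes x and sends y to y + eε, hence p to p + p_y e ε and q to q + q_y e ε;
  -- compare with the prescribed ε-coefficients.
  have hsol : ∀ i, ∃ e : M, ∀ j, m (pderiv 1 (f (X j))) * e = (Pi.single i 1 : Fin 2 → M) j := by
    intro i
    have hunit : IsUnit (dualHom f m i (Polynomial.C V)) := by
      rw [isUnit_iff_isUnit_fst, fst_dualHom, evalX_C]; exact hV
    obtain ⟨w, hw⟩ := hunit
    set y := dualHom f m i U * ↑w⁻¹ with hy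
    have hyU : dualHom f m i U = y * dualHom f m i (Polynomial.C V) := by
      rw [hy, ← hw, Units.inv_mul_cancel_right]
    have hfst : y.fst = m (X 1) := by
      have := congrArg fst hyU
      rw [fst_mul, fst_dualHom, fst_dualHom, hU, evalX_C, map_mul] at this
      exact (hV.mul_right_cancel this).symm
    refine ⟨y.snd, fun j => ?_⟩
    have := map_eq_aeval (dualHom f m i) (fun c => by
        have hc : f (C c) = C c := f.commutes c
        have hc' : m (C c) = algebraMap ℂ M c := m.commutes c
        simp [dualHom_C, hc, hc', algebraMap_eq_inl']) (fun G hG => by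
        obtain ⟨w, rfl⟩ := hf.dvd_of_evalX_eq_zero hH hH0 hG
        rw [map_mul, hdual, zero_mul]) hU ⟨w, hw⟩ hyU (evalX_C f (X j))
    have hpt : ![dualHom f m i Polynomial.X, y] =
        fun l => inl ((![m (X 0), m (X 1)] : Fin 2 → M) l) +
          inr ((![0, y.snd] : Fin 2 → M) l) := by
      ext l
      · fin_cases l <;> simp [dualHom_X, hfst]
      · fin_cases l <;> simp [dualHom_X]
    have hm : (aeval ![m (X 0), m (X 1)] : Poly →ₐ[ℂ] M) = m := by
      ext l
      fin_cases l <;> simp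
    rw [hpt, aeval_inl_add_inr, hm, dualHom_C] at this
    have := congrArg snd this
    simp only [snd_add, snd_inl, snd_inr, zero_add] at this
    fin_cases i <;> fin_cases j <;> simpa using this.symm
  obtain ⟨e₀, h₀⟩ := hsol 0
  obtain ⟨e₁, h₁⟩ := hsol 1
  have h₀₀ := h₀ 0
  have h₀₁ := h₀ 1
  have h₁₀ := h₁ 0
  have h₁₁ := h₁ 1
  simp at h₀₀ h₀₁ h₁₀ h₁₁
  -- Multiples of the single vector (p_y, q_y) give both standard basis vectors of M², which forces
  -- M = 0.
  calc (1 : M) = (m (pderiv 1 (f (X 0))) * e₀) * (m (pderiv 1 (f (X 1))) * e₁) := by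
        rw [h₀₀, h₁₁, one_mul]
    _ = (m (pderiv 1 (f (X 1))) * e₀) * (m (pderiv 1 (f (X 0))) * e₁) := by ring
    _ = 0 := by rw [h₁₀, mul_zero]

/-! ### The unit H'(x) and the equivalence. -/

theorem incl_evalX_mem (f : Poly →ₐ[ℂ] Poly) (G : Polynomial Poly) :
    incl (evalX f G) ∈ ringPQX f := by
  induction G using Polynomial.induction_on' with
  | add p q hp hq => rw [map_add, map_add]; exact add_mem hp hq
  | monomial n a =>
    rw [← Polynomial.C_mul_X_pow_eq_monomial, map_mul, map_pow, evalX_C, evalX_X, map_mul, map_pow]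
    exact mul_mem (ringPQ_le_ringPQX f (mem_ringPQ.2 ⟨a, rfl⟩))
      (pow_mem (Algebra.subset_adjoin (by simp [xx])) n)

theorem exists_incl_evalX_eq {f : Poly →ₐ[ℂ] Poly} {u : Rat2} (hu : u ∈ ringPQX f) :
    ∃ U, incl (evalX f U) = u := by
  induction hu using Algebra.adjoin_induction with
  | mem z hz =>
    rcases hz with rfl | rfl | rfl
    · exact ⟨Polynomial.C (X 0), by rw [evalX_C]; rfl⟩
    · exact ⟨Polynomial.C (X 1), by rw [evalX_C]; rfl⟩
    · exact ⟨Polynomial.X, by rw [evalX_X]; rfl⟩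
  | algebraMap c =>
    refine ⟨Polynomial.C (C c), ?_⟩
    have h : f (C c) = C c := f.commutes c
    rw [evalX_C, h]
    exact incl.commutes c
  | add a b _ _ ha hb =>
    obtain ⟨U, rfl⟩ := ha
    obtain ⟨V, rfl⟩ := hb
    exact ⟨U + V, by simp⟩
  | mul a b _ _ ha hb =>
    obtain ⟨U, rfl⟩ := ha
    obtain ⟨V, rfl⟩ := hb
    exact ⟨U * V, by simp⟩

theorem ringPQX_le_ringPQXInv (f : Poly →ₐ[ℂ] Poly) (v : Rat2) : ringPQX f ≤ ringPQXInv f v :=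
  Algebra.adjoin_mono (by intro z; simp; tauto)

/-- The derivative of an equation for `x` over `ℂ[p, q]` is a unit of `ℂ[p, q, x][1/v]`. -/
theorem IsJacobian.exists_unit_eq {f : Poly →ₐ[ℂ] Poly} (hf : IsJacobian f) {u v : Rat2}
    (huv : IsFractionForY f u v) {H : Polynomial Poly} (hH : Prime H) (hH0 : evalX f H = 0) :
    ∃ w : (ringPQXInv f v)ˣ,
      ((w : ringPQXInv f v) : Rat2) = incl (evalX f (Polynomial.derivative H)) := by
  obtain ⟨⟨hu, -⟩, ⟨hv, hv0⟩, hy⟩ := huv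
  obtain ⟨U, rfl⟩ := exists_incl_evalX_eq hu
  obtain ⟨V, rfl⟩ := mem_ringPQ.1 hv
  set R := ringPQXInv f (incl (f V))
  have hle : ∀ G, incl (evalX f G) ∈ R := fun G =>
    ringPQX_le_ringPQXInv f _ (incl_evalX_mem f G)
  have hinv : (incl (f V))⁻¹ ∈ R := Algebra.subset_adjoin (by simp)
  have hyR : yy ∈ R := by
    rw [hy, div_eq_mul_inv]
    exact mul_mem (hle U) hinv
  have hxR : xx ∈ R := by simpa [evalX_X, xx] using hle Polynomial.X
  -- Since y = u/v, the ring R contains all of ℂ[x,y].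
  let i : Poly →ₐ[ℂ] R := incl.codRestrict R (incl_mem_of_xx_mem_of_yy_mem hxR hyR)
  let h' : R := i (evalX f (Polynomial.derivative H))
  let m := (Ideal.Quotient.mkₐ ℂ (Ideal.span {h'})).comp i
  have hVunit : IsUnit (i (f V)) := by
    rw [isUnit_iff_exists_inv]
    exact ⟨⟨_, hinv⟩, Subtype.ext (mul_inv_cancel₀ hv0)⟩
  have hone := hf.one_eq_zero (M := R ⧸ Ideal.span {h'}) m hH hH0 (U := U) (V := V)
    (Ideal.Quotient.eq_zero_iff_mem.2 (Ideal.mem_span_singleton_self h')) ?_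
    (show IsUnit (Ideal.Quotient.mkₐ ℂ (Ideal.span {h'}) (i (f V))) from hVunit.map _)
  · have hmem : (1 : R) ∈ Ideal.span {h'} := Ideal.Quotient.eq_zero_iff_mem.1 hone
    rw [Ideal.mem_span_singleton] at hmem
    obtain ⟨w, hw⟩ := isUnit_of_dvd_one hmem
    exact ⟨w, by rw [hw]; rfl⟩
  · apply incl_injective
    rw [map_mul]
    exact ((eq_div_iff hv0).1 hy).symm

theorem IsJacobian.isBirational_of_unitsInFieldPQ {f : Poly →ₐ[ℂ] Poly} (hf : IsJacobian f)
    {u v : Rat2} (huv : IsFractionForY f u v) (h : UnitsInFieldPQ f v) : IsBirational f := by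
  obtain ⟨H, hH, hH0⟩ := hf.exists_prime_evalX_eq_zero
  obtain ⟨w, hw⟩ := hf.exists_unit_eq huv hH hH0
  obtain ⟨hmem, hne⟩ := h w
  rw [hw] at hmem hne
  obtain ⟨a, b, hab⟩ := mem_fieldPQ.1 hmem
  have hb : incl (f b) ≠ 0 := by
    intro hb
    rw [hb, div_zero] at hab
    exact hne hab
  have hb0 : b ≠ 0 := by
    rintro rfl
    simp at hb
  rw [eq_div_iff hb, ← map_mul] at hab
  have hab := incl_injective hab
  have hpos : H.natDegree ≠ 0 := by
    intro h0
    obtain ⟨r, rfl⟩ := Polynomial.natDegree_eq_zero.1 h0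
    rw [evalX_C] at hH0
    exact hH.ne_zero (by rw [hf.injective (hH0.trans (map_zero f).symm), Polynomial.C_0])
  -- H'(x) = a/b makes bH' - a a relation for x; its degree is below that of H, so it must vanish.
  have hdvd : H ∣ Polynomial.C b * Polynomial.derivative H - Polynomial.C a := by
    apply hf.dvd_of_evalX_eq_zero hH hH0
    rw [map_sub, map_mul, evalX_C, evalX_C, ← hab]
    ring
  have hdeg : (Polynomial.C b * Polynomial.derivative H).natDegree = H.natDegree - 1 := by
    rw [Polynomial.natDegree_C_mul hb0, Polynomial.natDegree_eq_of_degree_eq_some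
      (Polynomial.degree_derivative hpos)]
  have hzero := Polynomial.eq_zero_of_dvd_of_natDegree_lt hdvd (by
    rw [Polynomial.natDegree_sub_C, hdeg]; omega)
  -- bH' = a has T-degree 0, while in characteristic 0 the derivative lowers the degree by exactly
  -- one.
  have hone : H.natDegree = 1 := by
    rw [sub_eq_zero.1 hzero, Polynomial.natDegree_C] at hdeg
    omega
  have hx : xx ∈ fieldPQ f := by
    rw [Polynomial.eq_X_add_C_of_natDegree_le_one hone.le] at hH0
    simp only [map_add, map_mul, evalX_C, evalX_X] at hH0
    have hlc : H.coeff 1 ≠ 0 := by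
      rw [← hone]
      exact Polynomial.leadingCoeff_ne_zero.2 hH.ne_zero
    have hlc' : incl (f (H.coeff 1)) ≠ 0 :=
      (map_ne_zero_iff _ incl_injective).2 ((map_ne_zero_iff _ hf.injective).2 hlc)
    refine mem_fieldPQ.2 ⟨-H.coeff 0, H.coeff 1, ?_⟩
    rw [eq_div_iff hlc', xx, ← map_mul, map_neg]
    exact congrArg incl (by linear_combination hH0)
  rw [isBirational_iff]
  refine ⟨hx, hf.yy_mem ?_ ?_ hx⟩
  · exact IntermediateField.subset_adjoin _ _ (Or.inl rfl)
  · exact IntermediateField.subset_adjoin _ _ (Or.inr rfl)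

theorem unitsInFieldPQ_of_isBirational {f : Poly →ₐ[ℂ] Poly} (h : IsBirational f) (v : Rat2) :
    UnitsInFieldPQ f v := fun w =>
  ⟨by rw [h]; trivial, fun h0 => w.ne_zero (Subtype.ext h0)⟩

end KellerPlane

theorem mainTheorem3 (f : KellerPlane.Poly →ₐ[ℂ] KellerPlane.Poly)
    (hf : KellerPlane.IsJacobian f) :
    (∃ u v : KellerPlane.Rat2, KellerPlane.IsFractionForY f u v) ∧
    ∀ u v : KellerPlane.Rat2, KellerPlane.IsFractionForY f u v →
      List.TFAE [Function.Bijective f,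
        KellerPlane.IsBirational f,
        KellerPlane.UnitsInFieldPQ f v] := by
  refine ⟨hf.exists_isFractionForY, fun u v huv => ?_⟩
  tfae_have 1 → 2 := KellerPlane.isBirational_of_bijective
  tfae_have 2 → 1 := hf.bijective_of_isBirational
  tfae_have 2 → 3 := fun h => KellerPlane.unitsInFieldPQ_of_isBirational h v
  tfae_have 3 → 2 := hf.isBirational_of_unitsInFieldPQ huv
  tfae_finish
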